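/- Let $\mathcal{A}$ be a finite set of quantum systems, where each $v\in\mathcal{A}$ has a finite-dimensional Hilbert space $\mathcal{H}_v=\mathbb{C}^{d_v}$, and let $\rho$ be a density operator (positive semidefinite, of trace one) on $\mathcal{H}_{\mathcal{A}}=\bigotimes_{v\in\mathcal{A}}\mathcal{H}_v$. For $J\subseteq\mathcal{A}$ let $\rho_J$ be the marginal of $\rho$ on $\bigotimes_{v\in J}\mathcal{H}_v$, i.e. the partial trace of $\rho$ over the systems outside $J$. For a density operator $\sigma$ and $q>1$ let $S_q(\sigma)=\frac{1}{1-q}\left(\operatorname{Tr}\sigma^q-1\right)$ be the Tsallis entropy, and let $S_1(\sigma)=-\operatorname{Tr}\sigma\log\sigma$ be the von Neumann entropy. For $q\ge 1$ and $J\subseteq\mathcal{A}$ the $q$-deformed total correlation is $$C_q(J)_\rho=\sum_{v\in J}S_q(\rho_{\{v\}})-S_q(\rho_J).$$ Then, for every $q\ge 1$: 1. $C_q(I)_\rho\le C_q(J)_\rho$ whenever $I\subseteq J\subseteq\mathcal{A}$. 2. The sublevel sets $G(\varepsilon)_\rho=\{\varnothing\ne J\subseteq\mathcal{A} : C_q(J)_\rho\le\varepsilon\}$,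 $\varepsilon\in\mathbb{R}$, form a filtration of abstract simplicial complexes: each $G(\varepsilon)_\rho$ is closed under taking nonempty subsets of its members, and $G(\varepsilon)_\rho\subseteq G(\varepsilon')_\rho$ whenever $\varepsilon\le\varepsilon'$. -/

import Mathlib

open scoped ComplexOrder

/-- A quantum state (density operator) on the Hilbert space `ℂ^n` with orthonormal basis indexed
by the finite type `n`: a positive semidefinite matrix of trace one. -/
structure DensityMatrix (n : Type*) [Fintype n] where
  /-- The underlying complex matrix. -/
  toMatrix : Matrix n n ℂ
  posSemidef : toMatrix.PosSemidef
  trace_eq_one : toMatrix.trace = 1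

namespace DensityMatrix

section Entropy

variable {n : Type*} [Fintype n] [DecidableEq n]

/-- The von Neumann entropy `-Tr (ρ log ρ)`. The matrix `-ρ log ρ` is the function
`x ↦ -x log x` (with value `0` at `0`) applied to `ρ` by the functional calculus. -/
noncomputable def vonNeumannEntropy (ρ : DensityMatrix n) : ℝ :=
  (cfc Real.negMulLog ρ.toMatrix).trace.re

/-- The Tsallis entropy `S_q(ρ) = (Tr ρ^q - 1) / (1 - q)`; at `q = 1` it is the von Neumann
entropy, the limit of this expression as `q → 1`. The power `ρ^q` is the function `x ↦ x^q`
applied to `ρ` by the functional calculus. -/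
noncomputable def tsallisEntropy (q : ℝ) (ρ : DensityMatrix n) : ℝ :=
  if q = 1 then ρ.vonNeumannEntropy
  else 1 / (1 - q) * ((cfc (fun x : ℝ => x ^ q) ρ.toMatrix).trace.re - 1)

end Entropy

section Multipartite

variable {V : Type*} [Fintype V] [DecidableEq V] {d : V → Type*} [∀ v, Fintype (d v)]

/-- The marginal (reduced state) `ρ_J` of a state `ρ` on the tensor product of the `ℂ^(d v)`,
`v : V`: the partial trace over all the systems outside `J`. The tensor product has the product
basis, indexed by `∀ v, d v`. -/
def marginal (ρ : DensityMatrix (∀ v, d v)) (J : Finset V) :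
    DensityMatrix (∀ v : {v // v ∈ J}, d v) where
  toMatrix := Matrix.of fun a b => ∑ c : ∀ v : {v // ¬ v ∈ J}, d v,
    ρ.toMatrix ((Equiv.piEquivPiSubtypeProd (fun v => v ∈ J) d).symm (a, c))
      ((Equiv.piEquivPiSubtypeProd (fun v => v ∈ J) d).symm (b, c))
  posSemidef := by
    have h : (Matrix.of fun a b => ∑ c : ∀ v : {v // ¬ v ∈ J}, d v,
        ρ.toMatrix ((Equiv.piEquivPiSubtypeProd (fun v => v ∈ J) d).symm (a, c))
          ((Equiv.piEquivPiSubtypeProd (fun v => v ∈ J) d).symm (b, c))) =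
        ∑ c : ∀ v : {v // ¬ v ∈ J}, d v, ρ.toMatrix.submatrix
          (fun a => (Equiv.piEquivPiSubtypeProd (fun v => v ∈ J) d).symm (a, c))
          (fun a => (Equiv.piEquivPiSubtypeProd (fun v => v ∈ J) d).symm (a, c)) := by
      ext a b
      simp [Matrix.sum_apply]
    rw [h]
    exact Matrix.posSemidef_sum _ fun c _ => ρ.posSemidef.submatrix _
  trace_eq_one := by
    rw [← ρ.trace_eq_one]
    simp only [Matrix.trace, Matrix.diag_apply, Matrix.of_apply]
    rw [← Fintype.sum_prod_type'
      (f := fun a c => ρ.toMatrix ((Equiv.piEquivPiSubtypeProd (fun v => v ∈ J) d).symm (a, c))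
        ((Equiv.piEquivPiSubtypeProd (fun v => v ∈ J) d).symm (a, c)))]
    exact Equiv.sum_comp (Equiv.piEquivPiSubtypeProd (fun v => v ∈ J) d).symm
      (fun x => ρ.toMatrix x x)

variable [∀ v, DecidableEq (d v)]

/-- The `q`-deformed total correlation `C_q(J)_ρ = ∑_{v ∈ J} S_q(ρ_v) - S_q(ρ_J)`. -/
noncomputable def totalCorrelation (q : ℝ) (ρ : DensityMatrix (∀ v, d v)) (J : Finset V) : ℝ :=
  ∑ v ∈ J, (ρ.marginal {v}).tsallisEntropy q - (ρ.marginal J).tsallisEntropy q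

end Multipartite

end DensityMatrix

/-- The sublevel set `{J ∈ Δ : F J ≤ ε}` of a functional on the full simplex `Δ = 2^V \ {∅}`. -/
def sublevelFaces {V : Type*} (F : Finset V → ℝ) (ε : ℝ) : Set (Finset V) :=
  {J | J.Nonempty ∧ F J ≤ ε}

/-!
The total correlation grows by `S_q(w) + S_q(J) - S_q(J ∪ {w})` when a system `w` is added to `J`,
so both claims reduce to the subadditivity of `S_q` for a bipartite state. Conjugate the state by
the product of eigenbases of its two marginals: its spectrum does not change, and its diagonal
becomes a joint probability distribution whose marginals are the spectra of the marginal states.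
The diagonal of a Hermitian matrix is the image of its spectrum under a doubly stochastic matrix,
so by concavity the entropy of a state is at most that of its diagonal (Peierls' inequality), and
subadditivity is left to prove for probability distributions only.

There `S_q` is the sum of a function `f` over the distribution `p i j`, with marginals `x i` and
`y j`. The inequality `f (x * t) ≤ x * f t + t * f x`, applied to `p i j = x i * t` with the
conditional probability `t = p i j / x i`, separates off `∑ i, f (x i)`, and for each `j` concavity
bounds the remaining term `∑ i, x i * f (p i j / x i)` by `f (y j)`.
-/

/-- The properties of a function `f` that make `p ↦ ∑ i, f (p i)` a subadditive entropy of finite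
probability distributions. They hold for `x ↦ -x log x` and for its Tsallis deformations. -/
structure IsEntropyFunction (f : ℝ → ℝ) : Prop where
  concaveOn : ConcaveOn ℝ (Set.Ici 0) f
  map_zero : f 0 = 0
  map_mul_le : ∀ x ∈ Set.Icc (0 : ℝ) 1, ∀ y ∈ Set.Icc (0 : ℝ) 1, f (x * y) ≤ x * f y + y * f x

namespace IsEntropyFunction

theorem map_le_div {f : ℝ → ℝ} (hf : IsEntropyFunction f) {p x : ℝ} (hp : 0 ≤ p) (hpx : p ≤ x)
    (hx : x ≤ 1) : f p ≤ x * f (p / x) + p / x * f x := by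
  rcases (hp.trans hpx).eq_or_lt with rfl | hx0
  · simp [le_antisymm hpx hp, hf.map_zero]
  · simpa only [mul_div_cancel₀ p hx0.ne'] using hf.map_mul_le x ⟨hx0.le, hx⟩ (p / x)
      ⟨div_nonneg hp hx0.le, div_le_one_of_le₀ hpx hx0.le⟩

theorem sum_sum_le_sum_add_sum {f : ℝ → ℝ} (hf : IsEntropyFunction f) {m n : Type*} [Fintype m]
    [Fintype n] {p : m → n → ℝ} (hp : ∀ i j, 0 ≤ p i j) (hsum : ∑ i, ∑ j, p i j = 1) :
    ∑ i, ∑ j, f (p i j) ≤ ∑ i, f (∑ j, p i j) + ∑ j, f (∑ i, p i j) := by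
  set x : m → ℝ := fun i => ∑ j, p i j
  have hpx (i j) : p i j ≤ x i :=
    Finset.single_le_sum (fun j _ => hp i j) (Finset.mem_univ j)
  have hx0 (i) : 0 ≤ x i := Finset.sum_nonneg fun j _ => hp i j
  have hx1 (i) : x i ≤ 1 := hsum ▸ Finset.single_le_sum (fun i _ => hx0 i) (Finset.mem_univ i)
  have hrow (i) : ∑ j, p i j / x i * f (x i) = f (x i) := by
    rw [← Finset.sum_mul, ← Finset.sum_div]
    rcases eq_or_ne (x i) 0 with h | h
    · rw [h, hf.map_zero, mul_zero]
    · rw [div_self h, one_mul]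
  have hcol (j) : ∑ i, x i * f (p i j / x i) ≤ f (∑ i, p i j) := by
    -- At `x i = 0` the junk value `p i j / 0 = 0` is harmless, since then `p i j = 0`.
    have hcancel (i) : x i * (p i j / x i) = p i j :=
      mul_div_cancel_of_imp' fun h => le_antisymm (h ▸ hpx i j) (hp i j)
    simpa only [smul_eq_mul, hcancel] using hf.concaveOn.le_map_sum (t := Finset.univ) (w := x)
      (p := fun i => p i j / x i) (fun i _ => hx0 i) hsum fun i _ => div_nonneg (hp i j) (hx0 i)
  calc ∑ i, ∑ j, f (p i j)
      ≤ ∑ i, ∑ j, (x i * f (p i j / x i) + p i j / x i * f (x i)) := by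
        gcongr with i _ j _
        exact hf.map_le_div (hp i j) (hpx i j) (hx1 i)
    _ = ∑ i, ∑ j, p i j / x i * f (x i) + ∑ j, ∑ i, x i * f (p i j / x i) := by
        rw [Finset.sum_comm (s := (Finset.univ : Finset n)), ← Finset.sum_add_distrib]
        exact Finset.sum_congr rfl fun i _ => by rw [Finset.sum_add_distrib, add_comm]
    _ ≤ ∑ i, f (x i) + ∑ j, f (∑ i, p i j) := by
        simp only [hrow]
        gcongr with j _
        exact hcol j

end IsEntropyFunction

/-- The function `x ↦ (x - x ^ q) / (q - 1)`, read as its limit `x ↦ -x log x` at `q = 1`, whose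
sum over the spectrum of a state is the Tsallis entropy. -/
noncomputable def tsallisFun (q x : ℝ) : ℝ :=
  if q = 1 then Real.negMulLog x else (x - x ^ q) / (q - 1)

section tsallisFun

variable {q : ℝ}

theorem tsallisFun_one : tsallisFun 1 = Real.negMulLog :=
  funext fun _ => if_pos rfl

theorem tsallisFun_of_ne_one (hq : q ≠ 1) : tsallisFun q = fun x => (x - x ^ q) / (q - 1) :=
  funext fun _ => if_neg hq

theorem isEntropyFunction_negMulLog : IsEntropyFunction Real.negMulLog where
  concaveOn := Real.concaveOn_negMulLog
  map_zero := Real.negMulLog_zero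
  map_mul_le x _ y _ := by rw [Real.negMulLog_mul, add_comm]

theorem isEntropyFunction_sub_rpow_div (hq : 1 < q) :
    IsEntropyFunction fun x => (x - x ^ q) / (q - 1) where
  concaveOn := by
    simp only [div_eq_inv_mul]
    exact ((concaveOn_id (convex_Ici 0)).sub (convexOn_rpow hq.le)).smul
      (inv_nonneg.2 (sub_nonneg.2 hq.le))
  map_zero := by rw [Real.zero_rpow (by linarith), sub_zero, zero_div]
  map_mul_le x hx y hy := by
    have hxq : x ^ q ≤ x := Real.rpow_le_self_of_le_one hx.1 hx.2 hq.le
    have hyq : y ^ q ≤ y := Real.rpow_le_self_of_le_one hy.1 hy.2 hq.le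
    rw [Real.mul_rpow hx.1 hy.1, mul_div_assoc', mul_div_assoc', ← add_div]
    gcongr
    linear_combination mul_nonneg (sub_nonneg.2 hxq) (sub_nonneg.2 hyq)

theorem isEntropyFunction_tsallisFun (hq : 1 ≤ q) : IsEntropyFunction (tsallisFun q) := by
  rcases hq.eq_or_lt with rfl | hq
  · exact tsallisFun_one ▸ isEntropyFunction_negMulLog
  · exact tsallisFun_of_ne_one hq.ne' ▸ isEntropyFunction_sub_rpow_div hq

end tsallisFun

section Spectrum

variable {m n 𝕜 : Type*} [Fintype m] [DecidableEq m] [Fintype n] [DecidableEq n] [RCLike 𝕜]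
  {A : Matrix n n 𝕜} {B : Matrix m m 𝕜}

theorem sum_eigenvalues_eq_one (hA : A.IsHermitian) (htr : A.trace = 1) :
    ∑ i, hA.eigenvalues i = 1 := by
  rw [hA.trace_eq_sum_eigenvalues] at htr
  exact_mod_cast htr

theorem trace_cfc_eq_sum_eigenvalues (hA : A.IsHermitian) (f : ℝ → ℝ) :
    (cfc f A).trace = ((∑ i, f (hA.eigenvalues i) : ℝ) : 𝕜) := by
  rw [hA.cfc_eq, Matrix.IsHermitian.cfc, Unitary.conjStarAlgAut_apply, Matrix.trace_mul_cycle,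
    Unitary.coe_star_mul_self, one_mul, Matrix.trace_diagonal]
  simp only [Function.comp_apply, RCLike.ofReal_sum]

theorem trace_cfc_eq_sum_roots_charpoly (hA : A.IsHermitian) (f : ℝ → ℝ) :
    (cfc f A).trace = (A.charpoly.roots.map fun z => (f (RCLike.re z) : 𝕜)).sum := by
  simp [trace_cfc_eq_sum_eigenvalues hA, hA.roots_charpoly_eq_eigenvalues]

theorem trace_cfc_reindex (hA : A.IsHermitian) (e : n ≃ m) (f : ℝ → ℝ) :
    (cfc f (A.reindex e e)).trace = (cfc f A).trace := by
  have hA' : (A.reindex e e).IsHermitian := hA.submatrix e.symm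
  rw [trace_cfc_eq_sum_roots_charpoly hA', trace_cfc_eq_sum_roots_charpoly hA,
    Matrix.charpoly_reindex]

theorem trace_cfc_unitary_conj (hA : A.IsHermitian) (U : Matrix.unitaryGroup n 𝕜) (f : ℝ → ℝ) :
    (cfc f (star (U : Matrix n n 𝕜) * A * U)).trace = (cfc f A).trace := by
  have hA' : (star (U : Matrix n n 𝕜) * A * U).IsHermitian :=
    Matrix.isHermitian_conjTranspose_mul_mul _ hA
  rw [trace_cfc_eq_sum_roots_charpoly hA', trace_cfc_eq_sum_roots_charpoly hA,
    Matrix.charpoly_mul_comm, ← mul_assoc, Matrix.mem_unitaryGroup_iff.1 U.2, one_mul]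

theorem map_norm_sq_mem_doublyStochastic (U : Matrix.unitaryGroup n 𝕜) :
    (U : Matrix n n 𝕜).map (‖·‖ ^ 2) ∈ doublyStochastic ℝ n := by
  refine mem_doublyStochastic_iff_sum.2 ⟨fun i j => sq_nonneg _, fun i => ?_, fun j => ?_⟩
  · have h := congr_fun₂ (Matrix.mem_unitaryGroup_iff.1 U.2) i i
    simp only [Matrix.mul_apply, Matrix.star_apply, RCLike.star_def, RCLike.mul_conj,
      Matrix.one_apply_eq] at h
    exact_mod_cast h
  · have h := congr_fun₂ (Matrix.mem_unitaryGroup_iff'.1 U.2) j j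
    simp only [Matrix.mul_apply, Matrix.star_apply, RCLike.star_def, RCLike.conj_mul,
      Matrix.one_apply_eq] at h
    exact_mod_cast h

theorem sum_le_sum_mulVec_of_mem_doublyStochastic {P : Matrix n n ℝ} (hP : P ∈ doublyStochastic ℝ n)
    {f : ℝ → ℝ} {s : Set ℝ} (hf : ConcaveOn ℝ s f) {x : n → ℝ} (hx : ∀ i, x i ∈ s) :
    ∑ i, f (x i) ≤ ∑ i, f ((P.mulVec x) i) :=
  calc ∑ k, f (x k)
      = ∑ i, ∑ k, P i k * f (x k) := by
        rw [Finset.sum_comm]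
        simp only [← Finset.sum_mul, sum_col_of_mem_doublyStochastic hP, one_mul]
    _ ≤ ∑ i, f ((P.mulVec x) i) := Finset.sum_le_sum fun i _ =>
        hf.le_map_sum (fun k _ => nonneg_of_mem_doublyStochastic hP)
          (sum_row_of_mem_doublyStochastic hP i) fun k _ => hx k

theorem re_diag_eq_mulVec_eigenvalues (hA : A.IsHermitian) (i : n) :
    RCLike.re (A i i) = (((hA.eigenvectorUnitary : Matrix n n 𝕜).map (‖·‖ ^ 2)).mulVec
      hA.eigenvalues) i := by
  conv_lhs => rw [hA.spectral_theorem, Unitary.conjStarAlgAut_apply]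
  simp only [Matrix.mul_apply (M := _ * _), Matrix.mul_diagonal, Matrix.star_apply,
    Function.comp_apply, RCLike.star_def, mul_right_comm, RCLike.mul_conj, map_sum,
    Matrix.mulVec, dotProduct, Matrix.map_apply]
  exact Finset.sum_congr rfl fun k _ => by norm_cast

theorem re_trace_cfc_le_sum_diag (hA : A.IsHermitian) {f : ℝ → ℝ} {s : Set ℝ}
    (hf : ConcaveOn ℝ s f) (hs : ∀ i, hA.eigenvalues i ∈ s) :
    RCLike.re (cfc f A).trace ≤ ∑ i, f (RCLike.re (A i i)) := by
  rw [trace_cfc_eq_sum_eigenvalues hA, RCLike.ofReal_re]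
  simp only [re_diag_eq_mulVec_eigenvalues hA]
  exact sum_le_sum_mulVec_of_mem_doublyStochastic
    (map_norm_sq_mem_doublyStochastic hA.eigenvectorUnitary) hf hs

end Spectrum

section PartialTrace

open scoped Kronecker

variable {m n α : Type*}

/-- The partial trace over the second tensor factor, for matrices in a product basis. -/
def partialTraceRight [Fintype n] [AddCommMonoid α] (R : Matrix (m × n) (m × n) α) : Matrix m m α :=
  Matrix.of fun i i' => ∑ j, R (i, j) (i', j)

/-- The partial trace over the first tensor factor, for matrices in a product basis. -/
def partialTraceLeft [Fintype m] [AddCommMonoid α] (R : Matrix (m × n) (m × n) α) : Matrix n n α :=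
  partialTraceRight (R.submatrix Prod.swap Prod.swap)

theorem trace_partialTraceRight [Fintype m] [Fintype n] [AddCommMonoid α]
    (R : Matrix (m × n) (m × n) α) : (partialTraceRight R).trace = R.trace :=
  (Fintype.sum_prod_type fun x => R x x).symm

theorem isHermitian_partialTraceRight [Fintype n] [AddCommMonoid α] [StarAddMonoid α]
    {R : Matrix (m × n) (m × n) α} (hR : R.IsHermitian) : (partialTraceRight R).IsHermitian :=
  Matrix.IsHermitian.ext fun i i' => by
    simp only [partialTraceRight, Matrix.of_apply, star_sum, hR.apply]

theorem isHermitian_partialTraceLeft [Fintype m] [AddCommMonoid α] [StarAddMonoid α]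
    {R : Matrix (m × n) (m × n) α} (hR : R.IsHermitian) : (partialTraceLeft R).IsHermitian :=
  isHermitian_partialTraceRight (hR.submatrix _)

section CommSemiring

variable [Fintype m] [Fintype n] [CommSemiring α]

theorem partialTraceRight_kronecker_one_mul [DecidableEq n] (A : Matrix m m α)
    (R : Matrix (m × n) (m × n) α) :
    partialTraceRight (A ⊗ₖ (1 : Matrix n n α) * R) = A * partialTraceRight R := by
  ext i i'
  simp only [partialTraceRight, Matrix.of_apply, Matrix.mul_apply, Fintype.sum_prod_type,
    Matrix.kroneckerMap_apply, Matrix.one_apply, mul_ite, mul_one, mul_zero, ite_mul, zero_mul,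
    Finset.sum_ite_eq, Finset.mem_univ, if_true, Finset.mul_sum]
  exact Finset.sum_comm

theorem partialTraceRight_mul_kronecker_one [DecidableEq n] (R : Matrix (m × n) (m × n) α)
    (A : Matrix m m α) :
    partialTraceRight (R * A ⊗ₖ (1 : Matrix n n α)) = partialTraceRight R * A := by
  ext i i'
  simp only [partialTraceRight, Matrix.of_apply, Matrix.mul_apply, Fintype.sum_prod_type,
    Matrix.kroneckerMap_apply, Matrix.one_apply, mul_ite, mul_one, mul_zero,
    Finset.sum_ite_eq', Finset.mem_univ, if_true, Finset.sum_mul]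
  exact Finset.sum_comm

theorem partialTraceRight_one_kronecker_mul_comm [DecidableEq m] (B : Matrix n n α)
    (R : Matrix (m × n) (m × n) α) :
    partialTraceRight ((1 : Matrix m m α) ⊗ₖ B * R) =
      partialTraceRight (R * (1 : Matrix m m α) ⊗ₖ B) := by
  ext i i'
  simp only [partialTraceRight, Matrix.of_apply, Matrix.mul_apply, Fintype.sum_prod_type_right,
    Matrix.kroneckerMap_apply, Matrix.one_apply, ite_mul, one_mul, zero_mul, mul_ite, mul_zero,
    Finset.sum_ite_eq, Finset.sum_ite_eq', Finset.mem_univ, if_true]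
  rw [Finset.sum_comm]
  simp only [mul_comm]

end CommSemiring

variable [Fintype m] [Fintype n] [CommRing α] [StarRing α]

theorem partialTraceRight_kronecker_conj [DecidableEq n] (R : Matrix (m × n) (m × n) α)
    (U : Matrix m m α) {V : Matrix n n α} (hV : V ∈ Matrix.unitaryGroup n α) :
    partialTraceRight (star (U ⊗ₖ V) * R * U ⊗ₖ V) = star U * partialTraceRight R * U := by
  classical
  have hfactor : U ⊗ₖ V = (1 : Matrix m m α) ⊗ₖ V * U ⊗ₖ (1 : Matrix n n α) := by
    rw [← Matrix.mul_kronecker_mul, one_mul, mul_one]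
  have hstar : star (U ⊗ₖ V) = star U ⊗ₖ (1 : Matrix n n α) * (1 : Matrix m m α) ⊗ₖ star V := by
    rw [← Matrix.mul_kronecker_mul, one_mul, mul_one]
    exact Matrix.conjTranspose_kronecker U V
  calc partialTraceRight (star (U ⊗ₖ V) * R * U ⊗ₖ V)
      = partialTraceRight (star U ⊗ₖ (1 : Matrix n n α) *
          ((1 : Matrix m m α) ⊗ₖ star V * (R * (1 : Matrix m m α) ⊗ₖ V)) *
            U ⊗ₖ (1 : Matrix n n α)) := by
        rw [hstar, hfactor]
        simp only [mul_assoc]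
    _ = star U * partialTraceRight (R * ((1 : Matrix m m α) ⊗ₖ V * (1 : Matrix m m α) ⊗ₖ star V)) *
          U := by
        rw [partialTraceRight_mul_kronecker_one, partialTraceRight_kronecker_one_mul,
          partialTraceRight_one_kronecker_mul_comm, mul_assoc R]
    _ = star U * partialTraceRight R * U := by
        rw [← Matrix.mul_kronecker_mul, one_mul, Matrix.mem_unitaryGroup_iff.1 hV,
          Matrix.one_kronecker_one, mul_one]

theorem partialTraceLeft_kronecker_conj [DecidableEq m] (R : Matrix (m × n) (m × n) α)
    {U : Matrix m m α} (hU : U ∈ Matrix.unitaryGroup m α) (V : Matrix n n α) :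
    partialTraceLeft (star (U ⊗ₖ V) * R * U ⊗ₖ V) = star V * partialTraceLeft R * V := by
  have hswap : (U ⊗ₖ V).submatrix (Equiv.prodComm n m) (Equiv.prodComm n m) = V ⊗ₖ U := by
    ext x y
    exact mul_comm _ _
  have hconj : (star (U ⊗ₖ V) * R * U ⊗ₖ V).submatrix (Equiv.prodComm n m) (Equiv.prodComm n m) =
      star (V ⊗ₖ U) * R.submatrix (Equiv.prodComm n m) (Equiv.prodComm n m) * V ⊗ₖ U := by
    rw [← hswap, Matrix.star_eq_conjTranspose, Matrix.star_eq_conjTranspose,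
      Matrix.conjTranspose_submatrix, Matrix.submatrix_mul_equiv, Matrix.submatrix_mul_equiv]
  exact (congrArg partialTraceRight hconj).trans (partialTraceRight_kronecker_conj _ V hU)

end PartialTrace

section Bipartite

open scoped Kronecker

variable {m n 𝕜 : Type*} [Fintype m] [DecidableEq m] [Fintype n] [DecidableEq n] [RCLike 𝕜]

theorem re_star_eigenvectorUnitary_conj_diag {A : Matrix n n 𝕜} (hA : A.IsHermitian) (i : n) :
    RCLike.re ((star (hA.eigenvectorUnitary : Matrix n n 𝕜) * A * hA.eigenvectorUnitary) i i) =
      hA.eigenvalues i := by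
  rw [← Unitary.conjStarAlgAut_star_apply (S := 𝕜), hA.conjStarAlgAut_star_eigenvectorUnitary,
    Matrix.diagonal_apply_eq, Function.comp_apply, RCLike.ofReal_re]

theorem re_trace_cfc_le_add_partialTrace {R : Matrix (m × n) (m × n) 𝕜} (hR : R.PosSemidef)
    (htr : R.trace = 1) {f : ℝ → ℝ} (hf : IsEntropyFunction f) :
    RCLike.re (cfc f R).trace ≤
      RCLike.re (cfc f (partialTraceRight R)).trace +
        RCLike.re (cfc f (partialTraceLeft R)).trace := by
  have hA := isHermitian_partialTraceRight hR.isHermitian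
  have hB := isHermitian_partialTraceLeft hR.isHermitian
  let W : Matrix.unitaryGroup (m × n) 𝕜 :=
    ⟨_, Matrix.kronecker_mem_unitary hA.eigenvectorUnitary.2 hB.eigenvectorUnitary.2⟩
  set R' := star (W : Matrix (m × n) (m × n) 𝕜) * R * W with hR'_eq
  have hR' : R'.PosSemidef := hR.conjTranspose_mul_mul_same _
  set p : m → n → ℝ := fun i j => RCLike.re (R' (i, j) (i, j))
  have hp (i j) : 0 ≤ p i j := (RCLike.nonneg_iff.1 hR'.diag_nonneg).1
  have hrow (i) : ∑ j, p i j = hA.eigenvalues i := by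
    rw [← re_star_eigenvectorUnitary_conj_diag hA,
      ← partialTraceRight_kronecker_conj R _ hB.eigenvectorUnitary.2]
    exact (map_sum _ _ _).symm
  have hcol (j) : ∑ i, p i j = hB.eigenvalues j := by
    rw [← re_star_eigenvectorUnitary_conj_diag hB,
      ← partialTraceLeft_kronecker_conj R hA.eigenvectorUnitary.2]
    exact (map_sum _ _ _).symm
  have hsum : ∑ i, ∑ j, p i j = 1 := by
    simp only [hrow]
    exact sum_eigenvalues_eq_one hA ((trace_partialTraceRight R).trans htr)
  calc RCLike.re (cfc f R).trace
      = RCLike.re (cfc f R').trace := by rw [hR'_eq, trace_cfc_unitary_conj hR.isHermitian]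
    _ ≤ ∑ i, ∑ j, f (p i j) := by
        rw [← Fintype.sum_prod_type']
        exact re_trace_cfc_le_sum_diag hR'.isHermitian hf.concaveOn hR'.eigenvalues_nonneg
    _ ≤ ∑ i, f (∑ j, p i j) + ∑ j, f (∑ i, p i j) := hf.sum_sum_le_sum_add_sum hp hsum
    _ = _ := by
        simp only [hrow, hcol, trace_cfc_eq_sum_eigenvalues hA, trace_cfc_eq_sum_eigenvalues hB,
          RCLike.ofReal_re]

end Bipartite

namespace DensityMatrix

theorem tsallisEntropy_eq_re_trace_cfc {n : Type*} [Fintype n] [DecidableEq n]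
    (ρ : DensityMatrix n) (q : ℝ) :
    ρ.tsallisEntropy q = (cfc (tsallisFun q) ρ.toMatrix).trace.re := by
  rcases eq_or_ne q 1 with rfl | hq
  · rw [tsallisFun_one]
    exact if_pos rfl
  · rw [tsallisEntropy, if_neg hq, tsallisFun_of_ne_one hq,
      trace_cfc_eq_sum_eigenvalues ρ.posSemidef.isHermitian,
      trace_cfc_eq_sum_eigenvalues ρ.posSemidef.isHermitian, ← Finset.sum_div,
      Finset.sum_sub_distrib, sum_eigenvalues_eq_one _ ρ.trace_eq_one]
    have hq₁ : q - 1 ≠ 0 := sub_ne_zero.2 hq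
    have hq₂ : 1 - q ≠ 0 := sub_ne_zero.2 hq.symm
    simp only [Complex.coe_algebraMap, Complex.ofReal_re]
    field_simp
    ring

section Multipartite

open Function (updateFinset)

variable {V : Type*} [DecidableEq V] {d : V → Type*}

theorem restrict_union_eq_piFinsetUnion_iff {K L : Finset V} (h : Disjoint K L) (x : ∀ v, d v)
    (a : ∀ v : K, d v) (b : ∀ v : L, d v) :
    (K ∪ L).restrict x = Equiv.piFinsetUnion d h (a, b) ↔ K.restrict x = a ∧ L.restrict x = b := by
  have hx : (K ∪ L).restrict x = Equiv.piFinsetUnion d h (K.restrict x, L.restrict x) := by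
    conv_lhs => rw [← Function.updateFinset_restrict (s := L) x,
      ← Function.updateFinset_restrict (s := K) x, Function.updateFinset_updateFinset h,
      Function.restrict_updateFinset, Function.updateFinset_restrict]
  rw [hx, (Equiv.piFinsetUnion d h).apply_eq_iff_eq, Prod.mk.injEq]

theorem updateFinset_updateFinset_restrict {K L : Finset V} (h : Disjoint K L) (x : ∀ v, d v)
    (a : ∀ v : K, d v) :
    updateFinset (updateFinset x K a) L (L.restrict x) = updateFinset x K a := by
  have hL : L.restrict (updateFinset x K a) = L.restrict x := by
    ext v
    exact dif_neg fun hv => Finset.disjoint_left.1 h hv v.2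
  rw [← hL, Function.updateFinset_restrict]

variable [Fintype V] [∀ v, Fintype (d v)]

theorem marginal_apply [∀ v, DecidableEq (d v)] (ρ : DensityMatrix (∀ v, d v)) (J : Finset V)
    (a b : ∀ v : {v // v ∈ J}, d v) :
    (ρ.marginal J).toMatrix a b =
      ∑ x with J.restrict x = a, ρ.toMatrix x (updateFinset x J b) := by
  set e := Equiv.piEquivPiSubtypeProd (fun v => v ∈ J) d
  have hrestrict (a' c) : J.restrict (e.symm (a', c)) = a' := by
    ext v
    exact dif_pos v.2
  have hupdate (a' c) : updateFinset (e.symm (a', c)) J b = e.symm (b, c) := by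
    ext v
    by_cases hv : v ∈ J <;> simp [updateFinset, e, Equiv.piEquivPiSubtypeProd, hv]
  rw [Finset.sum_filter, ← Equiv.sum_comp e.symm, Fintype.sum_prod_type_right]
  simp only [hrestrict, hupdate, Finset.sum_ite_eq', Finset.mem_univ, if_true]
  rfl

theorem partialTraceRight_marginal_union (ρ : DensityMatrix (∀ v, d v)) {K L : Finset V}
    (h : Disjoint K L) :
    partialTraceRight ((ρ.marginal (K ∪ L)).toMatrix.reindex (Equiv.piFinsetUnion d h).symm
      (Equiv.piFinsetUnion d h).symm) = (ρ.marginal K).toMatrix := by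
  classical
  ext a a'
  simp only [partialTraceRight, Matrix.of_apply, Matrix.reindex_apply, Matrix.submatrix_apply,
    Equiv.symm_symm, marginal_apply, restrict_union_eq_piFinsetUnion_iff h,
    ← Function.updateFinset_updateFinset h, ← Finset.filter_filter]
  rw [← Finset.sum_fiberwise _ L.restrict]
  refine Finset.sum_congr rfl fun b _ => Finset.sum_congr rfl fun x hx => ?_
  rw [← (Finset.mem_filter.1 hx).2, updateFinset_updateFinset_restrict h]

theorem partialTraceLeft_marginal_union (ρ : DensityMatrix (∀ v, d v)) {K L : Finset V}
    (h : Disjoint K L) :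
    partialTraceLeft ((ρ.marginal (K ∪ L)).toMatrix.reindex (Equiv.piFinsetUnion d h).symm
      (Equiv.piFinsetUnion d h).symm) = (ρ.marginal L).toMatrix := by
  classical
  ext b b'
  simp only [partialTraceLeft, partialTraceRight, Matrix.of_apply, Matrix.reindex_apply,
    Matrix.submatrix_apply, Prod.swap_prod_mk, Equiv.symm_symm, marginal_apply,
    restrict_union_eq_piFinsetUnion_iff h, ← Function.updateFinset_updateFinset h,
    and_comm (a := K.restrict _ = _), ← Finset.filter_filter]
  rw [← Finset.sum_fiberwise _ K.restrict]
  refine Finset.sum_congr rfl fun a _ => Finset.sum_congr rfl fun x hx => ?_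
  rw [← (Finset.mem_filter.1 hx).2, Function.updateFinset_restrict]

variable [∀ v, DecidableEq (d v)]

theorem tsallisEntropy_marginal_union_le {q : ℝ} (hq : 1 ≤ q) (ρ : DensityMatrix (∀ v, d v))
    {K L : Finset V} (h : Disjoint K L) :
    (ρ.marginal (K ∪ L)).tsallisEntropy q ≤
      (ρ.marginal K).tsallisEntropy q + (ρ.marginal L).tsallisEntropy q := by
  set e := (Equiv.piFinsetUnion d h).symm
  set R := (ρ.marginal (K ∪ L)).toMatrix.reindex e e
  have hR : R.PosSemidef := (ρ.marginal (K ∪ L)).posSemidef.submatrix _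
  have htr : R.trace = 1 := by
    rw [← trace_partialTraceRight, partialTraceRight_marginal_union]
    exact (ρ.marginal K).trace_eq_one
  have hle := re_trace_cfc_le_add_partialTrace hR htr (isEntropyFunction_tsallisFun hq)
  rw [trace_cfc_reindex (ρ.marginal (K ∪ L)).posSemidef.isHermitian,
    partialTraceRight_marginal_union, partialTraceLeft_marginal_union] at hle
  simpa only [tsallisEntropy_eq_re_trace_cfc, RCLike.re_eq_complex_re] using hle

theorem monotone_totalCorrelation {q : ℝ} (hq : 1 ≤ q) (ρ : DensityMatrix (∀ v, d v)) :
    Monotone (ρ.totalCorrelation q) := by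
  refine Finset.monotone_iff_forall_le_insert.2 fun J w hw => ?_
  have hsub := ρ.tsallisEntropy_marginal_union_le hq (Finset.disjoint_singleton_left.2 hw)
  rw [← Finset.insert_eq] at hsub
  rw [totalCorrelation, totalCorrelation, Finset.sum_insert hw]
  linarith

end Multipartite

end DensityMatrix

/-- The filtration of the full simplex on `V` by the sublevel sets of a monotone functional. -/
def sublevelFiltration {V : Type*} {F : Finset V → ℝ} (hF : Monotone F) :
    ℝ →o PreAbstractSimplicialComplex V where
  toFun ε :=
    { faces := sublevelFaces F ε
      isRelLowerSet_faces := fun _ hJ => ⟨hJ.1, fun _ hIJ hI => ⟨hI, (hF hIJ).trans hJ.2⟩⟩ }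
  monotone' _ _ hε _ hJ := ⟨hJ.1, hJ.2.trans hε⟩

theorem mainTheorem7 {V : Type*} [Fintype V] [DecidableEq V]
    {d : V → Type*} [∀ v, Fintype (d v)] [∀ v, DecidableEq (d v)]
    (ρ : DensityMatrix (∀ v, d v)) (q : ℝ) (hq : 1 ≤ q) :
    (∀ I J : Finset V, I ⊆ J → ρ.totalCorrelation q I ≤ ρ.totalCorrelation q J) ∧
    ∃ G : ℝ →o PreAbstractSimplicialComplex V,
      ∀ ε : ℝ, (G ε).faces = sublevelFaces (ρ.totalCorrelation q) ε :=
  have hmono := ρ.monotone_totalCorrelation hq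
  ⟨fun _ _ hIJ => hmono hIJ, sublevelFiltration hmono, fun _ => rfl⟩
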